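/- For integers $d\ge 1$, $n\ge 2$, $k\ge 1$ let $E_n^d=\{0,1,\dots,n-1\}^d$. A function $f:E_n^d\to\{0,1\}$ is called $k$-threshold if there are real numbers $a_{ij}$ ($1\le i\le k$, $0\le j\le d$) such that $\{x\in E_n^d: f(x)=1\}=\{x\in E_n^d:\sum_{j=1}^d a_{ij}x_j\le a_{i0}\text{ for }i=1,\dots,k\}$; let $\mathfrak T(d,n,k)$ be the class of all $k$-threshold functions on $E_n^d$. Let $\mathcal C$ be a class of $\{0,1\}$-valued functions on a finite set $X$ and $f\in\mathcal C$. A set $T\subseteq X$ is a teaching set of $f$ with respect to $\mathcal C$ if $f$ is the only function in $\mathcal C$ that agrees with $f$ on $T$; a teaching set is minimal if no proper subset of it is a teaching set of $f$. Let $J(f,\mathcal C)$ be the number of minimal teaching sets of $f$ with respect to $\mathcal C$. A point $x\in X$ is essential for $f$ with respect to $\mathcal C$ if some $g\in\mathcal C$ satisfies $g(x)\ne f(x)$ and $g=f$ on $X\setminus\{x\}$; the set of these points is denoted $S(f,\mathcal C)$. Lemma. One has $$\max_{f\in\mathfrak T(2,n,2)}J(f,\mathfrak T(2,n,2))=\Omega(n^2),$$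 that is, there are $c>0$ and $N$ such that this maximum is at least $cn^2$ for all $n\ge N$. Moreover, put $m=\lfloor (n-1)/4\rfloor$, let $f_1^{(n)},f_2^{(n)}$ be the functions on $E_n^2$ whose sets of ones are given by $-3x_1-4x_2\le -25$ and by $3x_1+4x_2\le 12m-1$ respectively, and let $f^{(n)}=f_1^{(n)}\wedge f_2^{(n)}$. Let $R(n)\subset\mathbb R^2$ be the (closed, filled) triangle with vertices $(4m-3,2)$, $(1,3m-1)$, $(n-1,n-1)$ and let $L(n)$ be the segment joining $(4m-3,2)$ and $(1,3m-1)$. Then for every $n\ge 21$ we have $f_1^{(n)},f_2^{(n)}\in\mathfrak T(2,n,1)$ and $f^{(n)}\in\mathfrak T(2,n,2)$; for every $x\in (R(n)\setminus L(n))\cap E_n^2$ the set $$T_x=S(f_1^{(n)},\mathfrak T(2,n,1))\cup S(f_2^{(n)},\mathfrak T(2,n,1))\cup\{x\}$$ is a minimal teaching set of $f^{(n)}$ with respect to $\mathfrak T(2,n,2)$; and the sets $T_x$ are pairwise distinct. Also $J(f^{(n)},\mathfrak T(2,n,2))=\Omega(n^2)$. -/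

import Mathlib

namespace KThreshold

/-- The cube `{0, 1, …, n - 1}^d`. -/
abbrev Grid (d n : ℕ) : Type := Fin d → Fin n

/-- The class of `k`-threshold functions on `{0, …, n - 1}^d`: those `{0,1}`-valued functions whose
set of ones is cut out of the cube by `k` linear inequalities with real coefficients. -/
def thresholdClass (d n k : ℕ) : Set (Grid d n → Bool) :=
  {f | ∃ (a : Fin k → Fin d → ℝ) (a₀ : Fin k → ℝ),
    {x | f x = true} = {x | ∀ i, ∑ j, a i j * ((x j : ℕ) : ℝ) ≤ a₀ i}}

section Teaching

variable {X : Type*}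

/-- `T` is a teaching set of `f` with respect to `C`: the only member of `C` that agrees with `f`
on `T` is `f` itself. -/
def IsTeachingSet (f : X → Bool) (C : Set (X → Bool)) (T : Set X) : Prop :=
  ∀ g ∈ C, (∀ x ∈ T, g x = f x) → g = f

/-- A teaching set is minimal if none of its proper subsets is a teaching set. -/
def IsMinimalTeachingSet (f : X → Bool) (C : Set (X → Bool)) (T : Set X) : Prop :=
  IsTeachingSet f C T ∧ ∀ T' : Set X, T' ⊂ T → ¬ IsTeachingSet f C T'

/-- `J(f, C)`, the number of minimal teaching sets of `f` with respect to `C`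
(used for finite domains only). -/
noncomputable def numMinimalTeachingSets (f : X → Bool) (C : Set (X → Bool)) : ℕ :=
  Set.ncard {T : Set X | IsMinimalTeachingSet f C T}

/-- `S(f, C)`, the set of essential points of `f` with respect to `C`. -/
def essentialPoints (f : X → Bool) (C : Set (X → Bool)) : Set X :=
  {x | ∃ g ∈ C, f x ≠ g x ∧ ∀ y, y ≠ x → f y = g y}

end Teaching

/-- The maximum of `J(f, C)` over all `f` in the class `C` of `k`-threshold functions. -/
noncomputable def maxNumMinimalTeachingSets (d n k : ℕ) : ℕ :=
  sSup ((fun f => numMinimalTeachingSets f (thresholdClass d n k)) '' thresholdClass d n k)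

theorem thresholdClass_nonempty (d n k : ℕ) : (thresholdClass d n k).Nonempty :=
  ⟨fun _ => true, 0, 0, by simp⟩

/-- The supremum in `maxNumMinimalTeachingSets` is a maximum. -/
theorem isGreatest_maxNumMinimalTeachingSets (d n k : ℕ) :
    IsGreatest
      ((fun f => numMinimalTeachingSets f (thresholdClass d n k)) '' thresholdClass d n k)
      (maxNumMinimalTeachingSets d n k) := by
  have hfin : ((fun f => numMinimalTeachingSets f (thresholdClass d n k)) ''
      thresholdClass d n k).Finite := (Set.toFinite _).image _
  have hne := (thresholdClass_nonempty d n k).image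
    (fun f => numMinimalTeachingSets f (thresholdClass d n k))
  exact ⟨Nat.sSup_mem hne hfin.bddAbove, fun b hb => le_csSup hfin.bddAbove hb⟩

/-- `m(n) = ⌊(n - 1) / 4⌋`. -/
def mOf (n : ℕ) : ℕ := (n - 1) / 4

/-- The threshold function with inequality `-3 x₁ - 4 x₂ ≤ -25`. -/
def witness₁ (n : ℕ) : Grid 2 n → Bool :=
  fun x => decide (-3 * ((x 0 : ℕ) : ℤ) - 4 * ((x 1 : ℕ) : ℤ) ≤ -25)

/-- The threshold function with inequality `3 x₁ + 4 x₂ ≤ 12 m(n) - 1`. -/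
def witness₂ (n : ℕ) : Grid 2 n → Bool :=
  fun x => decide (3 * ((x 0 : ℕ) : ℤ) + 4 * ((x 1 : ℕ) : ℤ) ≤ 12 * (mOf n : ℤ) - 1)

/-- The 2-threshold function `f⁽ⁿ⁾ = f₁⁽ⁿ⁾ ∧ f₂⁽ⁿ⁾`. -/
def witness (n : ℕ) : Grid 2 n → Bool := fun x => witness₁ n x && witness₂ n x

/-- The point of the plane `ℝ²` given by a grid point. -/
def toPlane {n : ℕ} (x : Grid 2 n) : ℝ × ℝ := (((x 0 : ℕ) : ℝ), ((x 1 : ℕ) : ℝ))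

/-- The triangle `R(n)` with vertices `(4m - 3, 2)`, `(1, 3m - 1)` and `(n - 1, n - 1)`. -/
def triangleR (n : ℕ) : Set (ℝ × ℝ) :=
  convexHull ℝ {(4 * (mOf n : ℝ) - 3, 2), (1, 3 * (mOf n : ℝ) - 1), ((n : ℝ) - 1, (n : ℝ) - 1)}

/-- The segment `L(n)` joining `(4m - 3, 2)` and `(1, 3m - 1)`. -/
def segmentL (n : ℕ) : Set (ℝ × ℝ) :=
  segment ℝ (4 * (mOf n : ℝ) - 3, 2) (1, 3 * (mOf n : ℝ) - 1)

/-- The set `S(f₁⁽ⁿ⁾) ∪ S(f₂⁽ⁿ⁾) ∪ {x}`, where the essential points are taken with respect to the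
class of threshold functions. -/
def witnessTeachingSet (n : ℕ) (x : Grid 2 n) : Set (Grid 2 n) :=
  essentialPoints (witness₁ n) (thresholdClass 2 n 1) ∪
    essentialPoints (witness₂ n) (thresholdClass 2 n 1) ∪ {x}

end KThreshold

/-!
For `n ≥ 21` the ones of `f = witness n` lie between two parallel lines, and the half-planes `f₁`
and `f₂` have four essential points each: the extreme grid points on the consecutive lines
`3 x₁ + 4 x₂ = 24, 25`, respectively `3 x₁ + 4 x₂ = 12m - 1, 12m` (`corners₁`, `corners₂`). These
four points teach the half-plane (`isTeachingSet_corners₁`, `isTeachingSet_corners₂`), since they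
force the signs of the coefficients of any competing inequality, and every other grid point is then
settled by convexity or monotonicity; each of them is essential, since tilting the line flips it
alone (`mem_essentialPoints_of_tilt`).

The eight points do not teach `f` among intersections of two half-planes: they do not rule out
`{x₁ ≥ 1, x₂ ≥ 1}`, where one half-plane cuts off `(0, 6)` and `(0, 3m)` and the other cuts off
`(8, 0)` and `(4m, 0)`. One further zero `x` in `R(n) \ L(n)` decides which zeros share a
half-plane. The half-plane `g` excluding `x` excludes the vertex `V = (n - 1, n - 1)` of `R(n)`;
because the segments from `V` to `(0, 6)` and `(8, 0)` cross `L(n)`, whose endpoints are ones, `g`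
contains `(0, 6)` and `(8, 0)`. So the other half-plane excludes these two points, and then contains
`(4m, 0)` and `(0, 3m)`, which are therefore excluded by `g`. Hence both half-planes are those of
`f` (`eq_witness_of_eq_false`).

Minimality is by exhibiting a competitor for each removed point: the flipped half-plane for an
essential point, and `{x₁ ≥ 1, x₂ ≥ 1}` for `x`. Finally `R(n) \ L(n)` contains the `m²` grid points
of the box `2m ≤ x₁, x₂ < 3m`, and different `x` give different sets, whence the quadratic bound.
-/

namespace KThreshold

/-! ### Half-planes and grid points -/

theorem mem_thresholdClass_two_one {n : ℕ} {f : Grid 2 n → Bool} :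
    f ∈ thresholdClass 2 n 1 ↔
      ∃ a b c : ℝ, ∀ x, f x = true ↔ a * ((x 0 : ℕ) : ℝ) + b * ((x 1 : ℕ) : ℝ) ≤ c := by
  simp only [thresholdClass, Set.mem_ofPred_eq, Set.ext_iff, Fin.sum_univ_two, Fin.forall_fin_one]
  constructor
  · rintro ⟨a, c, h⟩
    exact ⟨a 0 0, a 0 1, c 0, h⟩
  · rintro ⟨a, b, c, h⟩
    exact ⟨fun _ => ![a, b], fun _ => c, by simpa using h⟩

theorem mem_thresholdClass_two_two {n : ℕ} {f : Grid 2 n → Bool} :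
    f ∈ thresholdClass 2 n 2 ↔
      ∃ g ∈ thresholdClass 2 n 1, ∃ h ∈ thresholdClass 2 n 1, f = fun x => g x && h x := by
  constructor
  · rintro ⟨a, c, h⟩
    simp only [Set.ext_iff, Set.mem_ofPred_eq, Fin.sum_univ_two, Fin.forall_fin_two] at h
    refine ⟨fun x => decide (a 0 0 * ((x 0 : ℕ) : ℝ) + a 0 1 * ((x 1 : ℕ) : ℝ) ≤ c 0),
      mem_thresholdClass_two_one.2 ⟨_, _, _, fun x => decide_eq_true_iff⟩,
      fun x => decide (a 1 0 * ((x 0 : ℕ) : ℝ) + a 1 1 * ((x 1 : ℕ) : ℝ) ≤ c 1),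
      mem_thresholdClass_two_one.2 ⟨_, _, _, fun x => decide_eq_true_iff⟩, ?_⟩
    ext x
    rw [Bool.eq_iff_iff, h]
    simp
  · rintro ⟨g, hg, h, hh, rfl⟩
    obtain ⟨a, b, c, hg⟩ := mem_thresholdClass_two_one.1 hg
    obtain ⟨a', b', c', hh⟩ := mem_thresholdClass_two_one.1 hh
    refine ⟨![![a, b], ![a', b']], ![c, c'], ?_⟩
    ext x
    simp [hg, hh, Fin.sum_univ_two, Fin.forall_fin_two]

theorem decide_mem_thresholdClass {n : ℕ} (a b c : ℤ) :
    (fun x : Grid 2 n => decide (a * ((x 0 : ℕ) : ℤ) + b * ((x 1 : ℕ) : ℤ) ≤ c)) ∈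
      thresholdClass 2 n 1 :=
  mem_thresholdClass_two_one.2 ⟨a, b, c, fun x => by
    rw [decide_eq_true_iff]; exact_mod_cast Iff.rfl⟩

theorem witness₁_eq_true {n : ℕ} {x : Grid 2 n} :
    witness₁ n x = true ↔ 25 ≤ 3 * (x 0 : ℕ) + 4 * (x 1 : ℕ) := by
  simp only [witness₁, decide_eq_true_iff]
  omega

theorem witness₂_eq_true {n : ℕ} {x : Grid 2 n} :
    witness₂ n x = true ↔ 3 * (x 0 : ℕ) + 4 * (x 1 : ℕ) < 12 * mOf n := by
  simp only [witness₂, decide_eq_true_iff]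
  omega

theorem witness_eq_true {n : ℕ} {x : Grid 2 n} :
    witness n x = true ↔
      25 ≤ 3 * (x 0 : ℕ) + 4 * (x 1 : ℕ) ∧ 3 * (x 0 : ℕ) + 4 * (x 1 : ℕ) < 12 * mOf n := by
  rw [witness, Bool.and_eq_true, witness₁_eq_true, witness₂_eq_true]

theorem witness₁_mem (n : ℕ) : witness₁ n ∈ thresholdClass 2 n 1 := by
  convert decide_mem_thresholdClass (n := n) (-3) (-4) (-25) using 2 with x
  rw [witness₁, neg_mul 4, sub_eq_add_neg]

theorem witness₂_mem (n : ℕ) : witness₂ n ∈ thresholdClass 2 n 1 :=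
  decide_mem_thresholdClass 3 4 (12 * (mOf n : ℤ) - 1)

theorem witness_mem (n : ℕ) : witness n ∈ thresholdClass 2 n 2 :=
  mem_thresholdClass_two_two.2 ⟨_, witness₁_mem n, _, witness₂_mem n, rfl⟩

/-- The grid point with coordinates `i` and `j`. -/
def pt {n : ℕ} (i j : ℕ) (hi : i < n) (hj : j < n) : Grid 2 n := ![⟨i, hi⟩, ⟨j, hj⟩]

@[simp] theorem pt_zero {n i j : ℕ} (hi : i < n) (hj : j < n) :
    ((pt i j hi hj 0 : Fin n) : ℕ) = i :=
  rfl

@[simp] theorem pt_one {n i j : ℕ} (hi : i < n) (hj : j < n) :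
    ((pt i j hi hj 1 : Fin n) : ℕ) = j :=
  rfl

theorem grid_ext {n : ℕ} {x y : Grid 2 n} (h₀ : (x 0 : ℕ) = y 0) (h₁ : (x 1 : ℕ) = y 1) :
    x = y := by
  funext i
  fin_cases i
  · exact Fin.ext h₀
  · exact Fin.ext h₁

/-! ### Essential points of the two half-planes -/

/-- A point `z` is essential for `f` if flipping `f` at `z` gives a function that is decided by the
side of a line `p x₁ + q x₂ = v`, and on this line by a second linear inequality: in a finite grid
this lexicographic rule is a single inequality, with a large weight `K` on the first functional. -/
theorem mem_essentialPoints_of_tilt {n : ℕ} {f : Grid 2 n → Bool} {z : Grid 2 n}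
    (p q v α β c : ℤ)
    (h : ∀ y : Grid 2 n, (f y = true ↔ ¬ ((y 0 : ℕ) = z 0 ∧ (y 1 : ℕ) = z 1)) ↔
      p * ((y 0 : ℕ) : ℤ) + q * ((y 1 : ℕ) : ℤ) < v ∨
      p * ((y 0 : ℕ) : ℤ) + q * ((y 1 : ℕ) : ℤ) = v ∧
        α * ((y 0 : ℕ) : ℤ) + β * ((y 1 : ℕ) : ℤ) ≤ c) :
    z ∈ essentialPoints f (thresholdClass 2 n 1) := by
  set K : ℤ := |α| * n + |β| * n + |c| + 1 with hK
  have key : ∀ y : Grid 2 n, (K * p + α) * ((y 0 : ℕ) : ℤ) + (K * q + β) * ((y 1 : ℕ) : ℤ)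
      ≤ K * v + c ↔ p * ((y 0 : ℕ) : ℤ) + q * ((y 1 : ℕ) : ℤ) < v ∨
      p * ((y 0 : ℕ) : ℤ) + q * ((y 1 : ℕ) : ℤ) = v ∧
        α * ((y 0 : ℕ) : ℤ) + β * ((y 1 : ℕ) : ℤ) ≤ c := by
    intro y
    have bound : ∀ (γ : ℤ) (i : Fin n), |γ * ((i : ℕ) : ℤ)| ≤ |γ| * n := by
      intro γ i
      rw [abs_mul, Nat.abs_cast]
      exact mul_le_mul_of_nonneg_left (by exact_mod_cast i.2.le) (abs_nonneg γ)
    have h0 := abs_le.1 (bound α (y 0))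
    have h1 := abs_le.1 (bound β (y 1))
    have hc := abs_le.1 (le_refl |c|)
    have hKpos : 0 < K := by positivity
    set u := p * ((y 0 : ℕ) : ℤ) + q * ((y 1 : ℕ) : ℤ) with hu
    have e : (K * p + α) * ((y 0 : ℕ) : ℤ) + (K * q + β) * ((y 1 : ℕ) : ℤ) =
        K * u + (α * ((y 0 : ℕ) : ℤ) + β * ((y 1 : ℕ) : ℤ)) := by rw [hu]; ring
    rw [e]
    rcases lt_trichotomy u v with huv | huv | huv
    · have : K * u ≤ K * v - K := by nlinarith
      simp only [huv, true_or, iff_true]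
      linarith
    · simp [huv]
    · have : K * v + K ≤ K * u := by nlinarith
      simp only [huv.not_gt, huv.ne', false_and, or_self, iff_false, not_le]
      linarith
  refine ⟨_, decide_mem_thresholdClass (K * p + α) (K * q + β) (K * v + c), ?_, fun y hy => ?_⟩
  · rw [Ne, Bool.eq_iff_iff, decide_eq_true_iff, key, ← h]
    tauto
  · have hy' : ¬ ((y 0 : ℕ) = z 0 ∧ (y 1 : ℕ) = z 1) := fun h' => hy (grid_ext h'.1 h'.2)
    rw [Bool.eq_iff_iff, decide_eq_true_iff, key, ← h]
    tauto

theorem essentialPoints_subset {X : Type*} {f : X → Bool} {C : Set (X → Bool)} {T : Set X}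
    (hT : IsTeachingSet f C T) : essentialPoints f C ⊆ T := by
  rintro z ⟨g, hg, hz, h⟩
  by_contra hzT
  refine hz (congrFun (hT g hg fun x hx => (h x ?_).symm) z).symm
  rintro rfl
  exact hzT hx

/-- The points `(0, 6)`, `(8, 0)`, `(3, 4)`, `(7, 1)`: the extreme grid points on the lines
`3 x₁ + 4 x₂ = 24` and `3 x₁ + 4 x₂ = 25`. -/
def corners₁ (n : ℕ) : Set (Grid 2 n) :=
  {z | (z 0 : ℕ) = 0 ∧ (z 1 : ℕ) = 6 ∨ (z 0 : ℕ) = 8 ∧ (z 1 : ℕ) = 0 ∨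
    (z 0 : ℕ) = 3 ∧ (z 1 : ℕ) = 4 ∨ (z 0 : ℕ) = 7 ∧ (z 1 : ℕ) = 1}

/-- The points `(4m, 0)`, `(0, 3m)`, `(4m - 3, 2)`, `(1, 3m - 1)`: the extreme grid points on the
lines `3 x₁ + 4 x₂ = 12m` and `3 x₁ + 4 x₂ = 12m - 1`. The subtractions are moved to the left-hand
sides to stay in `ℕ`. -/
def corners₂ (n : ℕ) : Set (Grid 2 n) :=
  {z | (z 0 : ℕ) = 4 * mOf n ∧ (z 1 : ℕ) = 0 ∨ (z 0 : ℕ) = 0 ∧ (z 1 : ℕ) = 3 * mOf n ∨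
    (z 0 : ℕ) + 3 = 4 * mOf n ∧ (z 1 : ℕ) = 2 ∨ (z 0 : ℕ) = 1 ∧ (z 1 : ℕ) + 1 = 3 * mOf n}

theorem five_le_mOf {n : ℕ} (hn : 21 ≤ n) : 5 ≤ mOf n := by
  unfold mOf
  omega

theorem four_mul_mOf_lt {n : ℕ} (hn : 21 ≤ n) : 4 * mOf n < n := by
  unfold mOf
  omega

theorem isTeachingSet_corners₁ {n : ℕ} (hn : 21 ≤ n) :
    IsTeachingSet (witness₁ n) (thresholdClass 2 n 1) (corners₁ n) := by
  intro g hg hT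
  obtain ⟨a, b, c, hg⟩ := mem_thresholdClass_two_one.1 hg
  have h1 := hT (pt 0 6 (by omega) (by omega)) (by simp [corners₁])
  have h2 := hT (pt 8 0 (by omega) (by omega)) (by simp [corners₁])
  have h3 := hT (pt 3 4 (by omega) (by omega)) (by simp [corners₁])
  have h4 := hT (pt 7 1 (by omega) (by omega)) (by simp [corners₁])
  rw [Bool.eq_iff_iff, hg, witness₁_eq_true] at h1 h2 h3 h4
  norm_num at h1 h2 h3 h4
  -- `24 (3, 4) = 9 (8, 0) + 16 (0, 6)` has coefficient sum `25 > 24`, which makes `c` negative.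
  have hc : c < 0 := by linarith
  have ha : a < 0 := by linarith
  have hb : b < 0 := by linarith
  ext x
  rw [Bool.eq_iff_iff, hg, witness₁_eq_true]
  generalize (x 0 : ℕ) = i
  generalize (x 1 : ℕ) = j
  have hi : (0 : ℝ) ≤ i := i.cast_nonneg
  have hj : (0 : ℝ) ≤ j := j.cast_nonneg
  constructor
  · intro h
    by_contra! hlt
    have hlt' : 3 * (i : ℝ) + 4 * j ≤ 24 := by exact_mod_cast Nat.lt_succ_iff.1 hlt
    -- `(i, j)` is a convex combination of `(0, 0)`, `(8, 0)` and `(0, 6)`.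
    rcases Nat.eq_zero_or_pos (i + j) with h0 | h0
    · obtain ⟨rfl, rfl⟩ : i = 0 ∧ j = 0 := by omega
      simp at h
      linarith
    · have hi' := mul_nonneg hi (sub_nonneg.2 h2.le)
      have hj' := mul_nonneg hj (sub_nonneg.2 h1.le)
      have hv : 0 ≤ (24 - (3 * (i : ℝ) + 4 * j)) * -c :=
        mul_nonneg (by linarith) (by linarith)
      rcases Nat.eq_zero_or_pos i with rfl | hpos
      · have : 0 < (j : ℝ) * (b * 6 - c) :=
          mul_pos (by exact_mod_cast (by omega : 0 < j)) (by linarith)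
        linarith
      · have : 0 < (i : ℝ) * (a * 8 - c) :=
          mul_pos (by exact_mod_cast hpos) (by linarith)
        linarith
  · -- Being a one is upward closed, as `a, b < 0`: only the minimal points matter.
    intro h
    have up : ∀ p q : ℕ, p ≤ i → q ≤ j → a * p + b * q ≤ c → a * i + b * j ≤ c := by
      intro p q hp hq hpq
      have hp' : (p : ℝ) ≤ i := by exact_mod_cast hp
      have hq' : (q : ℝ) ≤ j := by exact_mod_cast hq
      nlinarith
    have hcases : 9 ≤ i ∨ (7 ≤ i ∧ 1 ≤ j) ∨ (6 ≤ i ∧ 2 ≤ j) ∨ (5 ≤ i ∧ 3 ≤ j) ∨ (3 ≤ i ∧ 4 ≤ j) ∨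
        (2 ≤ i ∧ 5 ≤ j) ∨ (1 ≤ i ∧ 6 ≤ j) ∨ 7 ≤ j := by omega
    rcases hcases with h' | h' | h' | h' | h' | h' | h' | h'
    · exact up 9 0 h' (by omega) (by norm_num; linarith)
    · exact up 7 1 h'.1 h'.2 (by norm_num; linarith)
    · exact up 6 2 h'.1 h'.2 (by norm_num; linarith)
    · exact up 5 3 h'.1 h'.2 (by norm_num; linarith)
    · exact up 3 4 h'.1 h'.2 (by norm_num; linarith)
    · exact up 2 5 h'.1 h'.2 (by norm_num; linarith)
    · exact up 1 6 h'.1 h'.2 (by norm_num; linarith)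
    · exact up 0 7 (by omega) h' (by norm_num; linarith)

theorem essentialPoints_witness₁ {n : ℕ} (hn : 21 ≤ n) :
    essentialPoints (witness₁ n) (thresholdClass 2 n 1) = corners₁ n := by
  refine (essentialPoints_subset (isTeachingSet_corners₁ hn)).antisymm fun z hz => ?_
  -- On the line through the corner `z`, the second inequality singles out `z`, which is an extreme
  -- grid point of that line.
  rcases hz with ⟨h0, h1⟩ | ⟨h0, h1⟩ | ⟨h0, h1⟩ | ⟨h0, h1⟩
  · refine mem_essentialPoints_of_tilt (-3) (-4) (-24) 0 (-1) (-6) fun y => ?_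
    rw [witness₁_eq_true]; omega
  · refine mem_essentialPoints_of_tilt (-3) (-4) (-24) (-1) 0 (-8) fun y => ?_
    rw [witness₁_eq_true]; omega
  · refine mem_essentialPoints_of_tilt (-3) (-4) (-25) 0 1 1 fun y => ?_
    rw [witness₁_eq_true]; omega
  · refine mem_essentialPoints_of_tilt (-3) (-4) (-25) 1 0 3 fun y => ?_
    rw [witness₁_eq_true]; omega

theorem isTeachingSet_corners₂ {n : ℕ} (hn : 21 ≤ n) :
    IsTeachingSet (witness₂ n) (thresholdClass 2 n 1) (corners₂ n) := by
  intro g hg hT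
  obtain ⟨a, b, c, hg⟩ := mem_thresholdClass_two_one.1 hg
  have hm := five_le_mOf hn
  have hmn := four_mul_mOf_lt hn
  have h1 := hT (pt (4 * mOf n) 0 (by omega) (by omega)) (by simp [corners₂])
  have h2 := hT (pt 0 (3 * mOf n) (by omega) (by omega)) (by simp [corners₂])
  have h3 := hT (pt (4 * mOf n - 3) 2 (by omega) (by omega)) (by simp [corners₂]; omega)
  have h4 := hT (pt 1 (3 * mOf n - 1) (by omega) (by omega)) (by simp [corners₂]; omega)
  rw [Bool.eq_iff_iff, hg, witness₂_eq_true] at h1 h2 h3 h4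
  simp only [pt_zero, pt_one] at h1 h2 h3 h4
  replace h1 := not_le.1 (mt h1.1 (by omega))
  replace h2 := not_le.1 (mt h2.1 (by omega))
  replace h3 := h3.2 (by omega)
  replace h4 := h4.2 (by omega)
  rw [Nat.cast_sub (by omega)] at h3 h4
  push_cast at h1 h2 h3 h4
  have hmR : (5 : ℝ) ≤ mOf n := by exact_mod_cast hm
  have hx : ∀ x : Grid 2 n, g x = witness₂ n x := by
    intro x
    rw [Bool.eq_iff_iff, hg, witness₂_eq_true]
    clear hg hT hmn
    generalize mOf n = k at *
    generalize (x 0 : ℕ) = i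
    generalize (x 1 : ℕ) = j
    set m : ℝ := (k : ℝ) with hmk
    have hi : (0 : ℝ) ≤ i := i.cast_nonneg
    have hj : (0 : ℝ) ≤ j := j.cast_nonneg
    -- `12m (4m - 3, 2) = 3 (4m - 3) (4m, 0) + 8 (0, 3m)` has coefficient sum `12m - 1 < 12m`, which
    -- makes `c` positive.
    have hc : 0 < c := by nlinarith
    have ha : 0 < a := by nlinarith
    have hb : 0 < b := by nlinarith
    constructor
    · intro h
      by_contra! hle
      have hle' : 12 * m ≤ 3 * i + 4 * j := by rw [hmk]; exact_mod_cast hle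
      have hi' := mul_nonneg hi (sub_nonneg.2 h1.le)
      have hj' := mul_nonneg hj (sub_nonneg.2 h2.le)
      have hv := mul_nonneg (sub_nonneg.2 hle') hc.le
      have hv' : 0 ≤ 12 * m * (c - (a * i + b * j)) :=
        mul_nonneg (by linarith) (sub_nonneg.2 h)
      rcases Nat.eq_zero_or_pos i with rfl | hpos
      · have : 0 < (j : ℝ) * (a * 0 + b * (3 * m) - c) :=
          mul_pos (by exact_mod_cast (by omega : 0 < j)) (by linarith)
        push_cast at *
        linarith
      · have : 0 < (i : ℝ) * (a * (4 * m) + b * 0 - c) :=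
          mul_pos (by exact_mod_cast hpos) (by linarith)
        linarith
    · intro h
      -- The ones of `g` are downward closed, as `a, b > 0`. Points in the two lowest rows and in
      -- the first column are reached from `(4m - 3, 2)` and `(1, 3m - 1)` by moving right and down,
      -- respectively left and down; `a < b` pays for the moves to the right.
      have hab : a < b := by nlinarith
      by_cases hj2 : j < 2
      · have hij : (i : ℝ) + j ≤ 4 * m - 1 := by
          rw [hmk, le_sub_iff_add_le]
          exact_mod_cast (by omega : i + j + 1 ≤ 4 * k)
        have hj2' : (j : ℝ) ≤ 2 := by exact_mod_cast hj2.le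
        nlinarith [mul_nonneg (sub_nonneg.2 hij) ha.le, mul_nonneg (sub_nonneg.2 hj2')
          (sub_nonneg.2 hab.le)]
      rcases Nat.eq_zero_or_pos i with rfl | hpos
      · have : (j : ℝ) ≤ 3 * m - 1 := by
          rw [hmk, le_sub_iff_add_le]
          exact_mod_cast (by omega : j + 1 ≤ 3 * k)
        push_cast
        nlinarith [mul_nonneg (sub_nonneg.2 this) hb.le]
      · -- `(i, j)` is a convex combination of `(1, 2)`, `(4m - 3, 2)` and `(1, 3m - 1)`.
        have hi1 : (0 : ℝ) ≤ i - 1 := by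
          rw [sub_nonneg]
          exact_mod_cast hpos
        have hj1 : (0 : ℝ) ≤ j - 2 := by
          rw [sub_nonneg]
          exact_mod_cast not_lt.1 hj2
        have hv : 0 ≤ 12 * m - 1 - (3 * (i : ℝ) + 4 * j) := by
          rw [hmk, sub_nonneg, le_sub_iff_add_le]
          exact_mod_cast h
        have h12 : a + 2 * b ≤ c := by nlinarith
        have := mul_nonneg hv (sub_nonneg.2 h12)
        have := mul_nonneg hi1 (sub_nonneg.2 h3)
        have := mul_nonneg hj1 (sub_nonneg.2 h4)
        have : 0 ≤ (m - 1) * (c - (a * i + b * j)) := by nlinarith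
        exact sub_nonneg.1 (nonneg_of_mul_nonneg_right this (by linarith))
  exact funext hx

theorem essentialPoints_witness₂ {n : ℕ} (hn : 21 ≤ n) :
    essentialPoints (witness₂ n) (thresholdClass 2 n 1) = corners₂ n := by
  refine (essentialPoints_subset (isTeachingSet_corners₂ hn)).antisymm fun z hz => ?_
  have hm := five_le_mOf hn
  rcases hz with ⟨h0, h1⟩ | ⟨h0, h1⟩ | ⟨h0, h1⟩ | ⟨h0, h1⟩
  · refine mem_essentialPoints_of_tilt 3 4 (12 * mOf n) 0 1 0 fun y => ?_
    rw [witness₂_eq_true]; omega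
  · refine mem_essentialPoints_of_tilt 3 4 (12 * mOf n) 1 0 0 fun y => ?_
    rw [witness₂_eq_true]; omega
  · refine mem_essentialPoints_of_tilt 3 4 (12 * mOf n - 1) 0 (-1) (-3) fun y => ?_
    rw [witness₂_eq_true]; omega
  · refine mem_essentialPoints_of_tilt 3 4 (12 * mOf n - 1) (-1) 0 (-2) fun y => ?_
    rw [witness₂_eq_true]; omega

/-! ### The triangle `R(n)` -/

theorem mem_triangleR_iff {n : ℕ} {p : ℝ × ℝ} :
    p ∈ triangleR n ↔ ∃ u v w : ℝ, 0 ≤ u ∧ 0 ≤ v ∧ 0 ≤ w ∧ u + v + w = 1 ∧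
      u * (4 * mOf n - 3) + v * 1 + w * (n - 1) = p.1 ∧
      u * 2 + v * (3 * mOf n - 1) + w * (n - 1) = p.2 := by
  rw [triangleR, ← convexJoin_segment_singleton]
  simp only [mem_convexJoin, Set.mem_singleton_iff, exists_eq_left, segment, Set.mem_ofPred_eq]
  constructor
  · rintro ⟨q, ⟨s, t, hs, ht, hst, rfl⟩, α, β, hα, hβ, hαβ, rfl⟩
    refine ⟨α * s, α * t, β, by positivity, by positivity, hβ, ?_, ?_, ?_⟩
    · rw [← mul_add, hst, mul_one, hαβ]
    · simp; ring
    · simp; ring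
  · rintro ⟨u, v, w, hu, hv, hw, h, h1, h2⟩
    rcases (add_nonneg hu hv).eq_or_lt' with h0 | h0
    · obtain ⟨rfl, rfl⟩ := (add_eq_zero_iff_of_nonneg hu hv).1 h0
      refine ⟨_, ⟨1, 0, zero_le_one, le_rfl, add_zero 1, rfl⟩, 0, w, le_rfl, hw, by linarith, ?_⟩
      ext <;> simp [← h1, ← h2]
    · refine ⟨_, ⟨u / (u + v), v / (u + v), by positivity, by positivity, by field_simp, rfl⟩,
        u + v, w, h0.le, hw, h, ?_⟩
      ext
      · rw [← h1]; simp; field_simp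
      · rw [← h2]; simp; field_simp

/-- Points of `R(n) \ L(n)` lie strictly above the line through `L(n)`. -/
theorem lt_of_mem_triangleR_diff {n : ℕ} (hn : 21 ≤ n) {p : ℝ × ℝ}
    (hp : p ∈ triangleR n \ segmentL n) : 12 * (mOf n : ℝ) - 1 < 3 * p.1 + 4 * p.2 := by
  obtain ⟨hR, hL⟩ := hp
  obtain ⟨u, v, w, hu, hv, hw, h, h1, h2⟩ := mem_triangleR_iff.1 hR
  have hmn : 4 * (mOf n : ℝ) + 1 ≤ n := by exact_mod_cast four_mul_mOf_lt hn
  have hm : (5 : ℝ) ≤ mOf n := by exact_mod_cast five_le_mOf hn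
  rcases hw.eq_or_lt with rfl | hw
  · refine absurd ⟨u, v, hu, hv, by linarith, ?_⟩ hL
    ext
    · rw [← h1]; simp
    · rw [← h2]; simp
  · have : 0 < w * (7 * ((n : ℝ) - 1) - 12 * mOf n + 1) := mul_pos hw (by linarith)
    have hu' : u = 1 - v - w := by linarith
    subst hu'
    nlinarith

theorem one_le_two_le_of_mem_triangleR {n : ℕ} (hn : 21 ≤ n) {p : ℝ × ℝ}
    (hp : p ∈ triangleR n) : 1 ≤ p.1 ∧ 2 ≤ p.2 := by
  obtain ⟨u, v, w, hu, hv, hw, h, h1, h2⟩ := mem_triangleR_iff.1 hp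
  have hmn : 4 * (mOf n : ℝ) + 1 ≤ n := by exact_mod_cast four_mul_mOf_lt hn
  have hm : (5 : ℝ) ≤ mOf n := by exact_mod_cast five_le_mOf hn
  rw [← h1, ← h2]
  have e1 : 0 ≤ u * (4 * (mOf n : ℝ) - 4) := mul_nonneg hu (by linarith)
  have e2 : 0 ≤ w * ((n : ℝ) - 3) := mul_nonneg hw (by linarith)
  have e3 : 0 ≤ v * (3 * (mOf n : ℝ) - 3) := mul_nonneg hv (by linarith)
  constructor <;> nlinarith

/-- A quadratic-size box of points of `R(n) \ L(n)`. -/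
theorem toPlane_mem_of_box {n : ℕ} (hn : 21 ≤ n) {x : Grid 2 n}
    (h0 : 2 * mOf n ≤ (x 0 : ℕ)) (h0' : (x 0 : ℕ) < 3 * mOf n)
    (h1 : 2 * mOf n ≤ (x 1 : ℕ)) (h1' : (x 1 : ℕ) < 3 * mOf n) :
    toPlane x ∈ triangleR n \ segmentL n := by
  have hmn : 4 * (mOf n : ℝ) + 1 ≤ n := by exact_mod_cast four_mul_mOf_lt hn
  have hm : (5 : ℝ) ≤ mOf n := by exact_mod_cast five_le_mOf hn
  have g0 : 2 * (mOf n : ℝ) ≤ (x 0 : ℕ) := by exact_mod_cast h0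
  have g0' : ((x 0 : ℕ) : ℝ) + 1 ≤ 3 * mOf n := by exact_mod_cast h0'
  have g1 : 2 * (mOf n : ℝ) ≤ (x 1 : ℕ) := by exact_mod_cast h1
  have g1' : ((x 1 : ℕ) : ℝ) + 1 ≤ 3 * mOf n := by exact_mod_cast h1'
  simp only [toPlane]
  generalize ((x 0 : ℕ) : ℝ) = s at *
  generalize ((x 1 : ℕ) : ℝ) = t at *
  set m : ℝ := (mOf n : ℝ) with hmdef
  set N : ℝ := (n : ℝ) - 1 with hN
  constructor
  · rw [mem_triangleR_iff, ← hmdef, ← hN]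
    -- Barycentric coordinates by Cramer's rule; twice the area of `R(n)` is `(m - 1) D`.
    obtain ⟨D, hDdef⟩ : ∃ D, 7 * N - 12 * m + 1 = D := ⟨_, rfl⟩
    have hD : 0 < 7 * N - 12 * m + 1 := by linarith
    have hm1 : 0 < m - 1 := by linarith
    refine ⟨((s - 1) * (N - 3 * m + 1) + (3 * m - 1 - t) * (N - 1)) /
        ((m - 1) * (7 * N - 12 * m + 1)),
      ((N - 4 * m + 3) * (t - 2) + (N - 2) * (4 * m - 3 - s)) /
        ((m - 1) * (7 * N - 12 * m + 1)),
      (3 * s + 4 * t - 12 * m + 1) / (7 * N - 12 * m + 1), ?_, ?_, ?_, ?_, ?_, ?_⟩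
    · refine div_nonneg (add_nonneg (mul_nonneg ?_ ?_) (mul_nonneg ?_ ?_)) (mul_pos hm1 hD).le <;>
        linarith
    · refine div_nonneg (add_nonneg (mul_nonneg ?_ ?_) (mul_nonneg ?_ ?_)) (mul_pos hm1 hD).le <;>
        linarith
    · exact div_nonneg (by linarith) hD.le
    all_goals
      rw [hDdef] at hD ⊢
      field_simp
      rw [← hDdef]
      ring
  · rintro ⟨u, v, hu, hv, huv, h⟩
    have e1 := congrArg Prod.fst h
    have e2 := congrArg Prod.snd h
    simp only [Prod.fst_add, Prod.snd_add, Prod.smul_fst, Prod.smul_snd, smul_eq_mul] at e1 e2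
    obtain rfl : u = 1 - v := by linarith
    rw [← hmdef] at e1 e2
    nlinarith

/-! ### Zeros that no half-plane can separate together from the ones -/

/-- If a half-plane contains `P = (4m - 3, 2)` and `Q = (1, 3m - 1)` but not some point of the
triangle `R(n)`, then it contains `(0, 6)` and `(8, 0)`. Indeed it does not contain the third vertex
`V` of the triangle; if `(0, 6)` or `(8, 0)` were missing as well, the whole segment from that point
to `V` would be, but this segment meets the segment `PQ`. -/
theorem contains_of_not_mem_triangleR {n : ℕ} (hn : 21 ≤ n) {a b c : ℝ} {p : ℝ × ℝ}
    (hp : p ∈ triangleR n) (hpc : c < a * p.1 + b * p.2)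
    (hP : a * (4 * mOf n - 3) + b * 2 ≤ c) (hQ : a * 1 + b * (3 * mOf n - 1) ≤ c) :
    b * 6 ≤ c ∧ a * 8 ≤ c := by
  obtain ⟨u, v, w, hu, hv, hw, h, h1, h2⟩ := mem_triangleR_iff.1 hp
  have hmn : 4 * (mOf n : ℝ) + 1 ≤ n := by exact_mod_cast four_mul_mOf_lt hn
  have hm : (5 : ℝ) ≤ mOf n := by exact_mod_cast five_le_mOf hn
  rw [← h1, ← h2] at hpc
  set m : ℝ := (mOf n : ℝ)
  set N : ℝ := (n : ℝ) - 1 with hN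
  have hmN : 4 * m ≤ N := by linarith
  have hV : c < a * N + b * N := by
    by_contra! hV
    have e1 := mul_nonneg hu (sub_nonneg.2 hP)
    have e2 := mul_nonneg hv (sub_nonneg.2 hQ)
    have e3 := mul_nonneg hw (sub_nonneg.2 hV)
    have e4 : u * c + v * c + w * c = c := by rw [← add_mul, ← add_mul, h, one_mul]
    linarith
  have hμ : 0 < (m - 1) * (7 * N - 12 * m + 1) := mul_pos (by linarith) (by linarith)
  have hl : 0 < (m - 1) * (12 * m - 25) := mul_pos (by linarith) (by linarith)
  -- The weights of the four inequalities added up below are, in both cases, the doubled areas of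
  -- the triangles spanned by the other three of the four points.
  constructor
  · by_contra! hA
    have hα : 0 < N * (3 * m - 8) + 6 :=
      add_pos (mul_pos (by linarith) (by linarith)) (by norm_num)
    have hβ : 0 < (N - 6) * (4 * m - 3) + 4 * N :=
      add_pos (mul_pos (by linarith) (by linarith)) (by linarith)
    have e1 := mul_nonneg hα.le (sub_nonneg.2 hP)
    have e2 := mul_nonneg hβ.le (sub_nonneg.2 hQ)
    have e3 := mul_pos hμ (sub_pos.2 hA)
    have e4 := mul_pos hl (sub_pos.2 hV)
    linarith
  · by_contra! hA
    have hα : 0 < (N - 8) * (3 * m - 1) + 7 * N :=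
      add_pos (mul_pos (by linarith) (by linarith)) (by linarith)
    have hβ : 0 < N * (4 * m - 13) + 16 :=
      add_pos (mul_pos (by linarith) (by linarith)) (by norm_num)
    have e1 := mul_nonneg hα.le (sub_nonneg.2 hP)
    have e2 := mul_nonneg hβ.le (sub_nonneg.2 hQ)
    have e3 := mul_pos hμ (sub_pos.2 hA)
    have e4 := mul_pos hl (sub_pos.2 hV)
    linarith

/-- If a half-plane contains `(3, 4)` and `(4m - 3, 2)`, it cannot avoid both `(0, 6)` and
`(4m, 0)`: these four points form a parallelogram with the two pairs as diagonals. -/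
theorem contains_right {m a b c : ℝ} (h1 : a * 3 + b * 4 ≤ c)
    (h2 : a * (4 * m - 3) + b * 2 ≤ c) (h3 : c < b * 6) : a * (4 * m) ≤ c := by
  linarith

/-- If a half-plane contains `(7, 1)` and `(1, 3m - 1)`, it cannot avoid both `(8, 0)` and
`(0, 3m)`: these four points form a parallelogram with the two pairs as diagonals. -/
theorem contains_left {m a b c : ℝ} (h1 : a * 7 + b * 1 ≤ c)
    (h2 : a * 1 + b * (3 * m - 1) ≤ c) (h3 : c < a * 8) : b * (3 * m) ≤ c := by
  linarith

/-! ### The sets `T_x` -/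

theorem isMinimalTeachingSet_of_diff {X : Type*} {f : X → Bool} {C : Set (X → Bool)} {T : Set X}
    (hT : IsTeachingSet f C T)
    (h : ∀ z ∈ T, ∃ g ∈ C, g ≠ f ∧ ∀ y ∈ T, y ≠ z → g y = f y) : IsMinimalTeachingSet f C T := by
  refine ⟨hT, fun T' hT' hteach => ?_⟩
  obtain ⟨z, hz, hz'⟩ := Set.exists_of_ssubset hT'
  obtain ⟨g, hg, hne, hgT⟩ := h z hz
  exact hne (hteach g hg fun y hy => hgT y (hT'.1 hy) (by rintro rfl; exact hz' hy))

theorem witnessTeachingSet_eq {n : ℕ} (hn : 21 ≤ n) (x : Grid 2 n) :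
    witnessTeachingSet n x = corners₁ n ∪ corners₂ n ∪ {x} := by
  rw [witnessTeachingSet, essentialPoints_witness₁ hn, essentialPoints_witness₂ hn]

theorem twelve_mul_mOf_le {n : ℕ} (hn : 21 ≤ n) {x : Grid 2 n}
    (hx : toPlane x ∈ triangleR n \ segmentL n) :
    12 * mOf n ≤ 3 * (x 0 : ℕ) + 4 * (x 1 : ℕ) := by
  have h := lt_of_mem_triangleR_diff hn hx
  rw [sub_lt_iff_lt_add] at h
  simp only [toPlane] at h
  exact Nat.lt_succ_iff.1 (by exact_mod_cast h)

theorem notMem_corners {n : ℕ} (hn : 21 ≤ n) {x : Grid 2 n}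
    (hx : toPlane x ∈ triangleR n \ segmentL n) : x ∉ corners₁ n ∪ corners₂ n := by
  have h := twelve_mul_mOf_le hn hx
  have hm := five_le_mOf hn
  obtain ⟨h0, h1⟩ := one_le_two_le_of_mem_triangleR hn hx.1
  simp only [toPlane] at h0 h1
  have h0' : 1 ≤ (x 0 : ℕ) := by exact_mod_cast h0
  have h1' : 2 ≤ (x 1 : ℕ) := by exact_mod_cast h1
  simp only [corners₁, corners₂, Set.mem_union, Set.mem_ofPred_eq]
  omega

theorem injOn_witnessTeachingSet {n : ℕ} (hn : 21 ≤ n) :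
    Set.InjOn (witnessTeachingSet n) {x | toPlane x ∈ triangleR n \ segmentL n} := by
  intro x hx y _ hxy
  have : x ∈ witnessTeachingSet n y := hxy ▸ Or.inr rfl
  rw [witnessTeachingSet_eq hn] at this
  exact this.resolve_left (notMem_corners hn hx)

/-- If `g` avoids a point of `R(n)` and `g ∧ h` agrees with `f` on the eight corners, then `h` cuts
off the corners `(0, 6)` and `(8, 0)`, hence `g` cuts off `(4m, 0)` and `(0, 3m)`, and the two
half-planes are those of `f`. -/
theorem eq_witness_of_eq_false {n : ℕ} (hn : 21 ≤ n) {g h : Grid 2 n → Bool}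
    (hg : g ∈ thresholdClass 2 n 1) (hh : h ∈ thresholdClass 2 n 1) {x : Grid 2 n}
    (hx : toPlane x ∈ triangleR n) (hgx : g x = false)
    (hT : ∀ y ∈ corners₁ n ∪ corners₂ n, (g y && h y) = witness n y) :
    g = witness₂ n ∧ h = witness₁ n := by
  obtain ⟨a, b, c, hga⟩ := mem_thresholdClass_two_one.1 hg
  obtain ⟨a', b', c', hha⟩ := mem_thresholdClass_two_one.1 hh
  have hm := five_le_mOf hn
  have hmn := four_mul_mOf_lt hn
  have T (i j : ℕ) (hi : i < n) (hj : j < n) (hc : pt i j hi hj ∈ corners₁ n ∪ corners₂ n) :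
      (a * i + b * j ≤ c ∧ a' * i + b' * j ≤ c') ↔
        25 ≤ 3 * i + 4 * j ∧ 3 * i + 4 * j < 12 * mOf n := by
    have := hT _ hc
    rwa [Bool.eq_iff_iff, Bool.and_eq_true, hga, hha, witness_eq_true] at this
  have z1 := mt (T 0 6 (by omega) (by omega) (by simp [corners₁])).1 (by omega)
  have z2 := mt (T 8 0 (by omega) (by omega) (by simp [corners₁])).1 (by omega)
  have o1 := (T 3 4 (by omega) (by omega) (by simp [corners₁])).2 (by omega)
  have o2 := (T 7 1 (by omega) (by omega) (by simp [corners₁])).2 (by omega)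
  have z3 := mt (T (4 * mOf n) 0 (by omega) (by omega) (by simp [corners₂])).1 (by omega)
  have z4 := mt (T 0 (3 * mOf n) (by omega) (by omega) (by simp [corners₂])).1 (by omega)
  have o3 := (T (4 * mOf n - 3) 2 (by omega) (by omega) (by simp [corners₂]; omega)).2 (by omega)
  have o4 := (T 1 (3 * mOf n - 1) (by omega) (by omega) (by simp [corners₂]; omega)).2 (by omega)
  rw [Nat.cast_sub (by omega)] at o3 o4
  push_cast at z1 z2 z3 z4 o1 o2 o3 o4
  simp only [mul_zero, zero_add, add_zero] at z1 z2 z3 z4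
  have hgx' : c < a * (toPlane x).1 + b * (toPlane x).2 :=
    not_le.1 (mt (hga x).2 (by simp [hgx]))
  obtain ⟨k1, k2⟩ := contains_of_not_mem_triangleR hn hx hgx' o3.1 o4.1
  have l1 : c' < b' * 6 := by
    by_contra! hle
    exact z1 ⟨k1, hle⟩
  have l2 : c' < a' * 8 := by
    by_contra! hle
    exact z2 ⟨k2, hle⟩
  have l3 := contains_right o1.2 o3.2 l1
  have l4 := contains_left o2.2 o4.2 l2
  have hh₂ : ∀ y ∈ corners₂ n, h y = true := by
    intro y hy
    rw [hha]
    rcases hy with ⟨h0, h1⟩ | ⟨h0, h1⟩ | ⟨h0, h1⟩ | ⟨h0, h1⟩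
    · rw [h0, h1]
      push_cast
      linarith
    · rw [h0, h1]
      push_cast
      linarith
    · have h0' : ((y 0 : ℕ) : ℝ) = 4 * mOf n - 3 := by
        rw [eq_sub_iff_add_eq]
        exact_mod_cast h0
      rw [h0', h1]
      exact o3.2
    · have h1' : ((y 1 : ℕ) : ℝ) = 3 * mOf n - 1 := by
        rw [eq_sub_iff_add_eq]
        exact_mod_cast h1
      rw [h0, h1', Nat.cast_one]
      exact o4.2
  have hg₁ : ∀ y ∈ corners₁ n, g y = true := by
    intro y hy
    rw [hga]
    rcases hy with ⟨h0, h1⟩ | ⟨h0, h1⟩ | ⟨h0, h1⟩ | ⟨h0, h1⟩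
    all_goals
      rw [h0, h1]
      push_cast
      linarith
  refine ⟨isTeachingSet_corners₂ hn g hg fun y hy => ?_,
    isTeachingSet_corners₁ hn h hh fun y hy => ?_⟩
  · have hw : witness₁ n y = true := by
      rw [witness₁_eq_true]
      rcases hy with h | h | h | h <;> omega
    simpa [witness, hw, hh₂ y hy] using hT y (Or.inr hy)
  · have hw : witness₂ n y = true := by
      rw [witness₂_eq_true]
      rcases hy with h | h | h | h <;> omega
    simpa [witness, hw, hg₁ y hy] using hT y (Or.inl hy)

theorem isTeachingSet_witnessTeachingSet {n : ℕ} (hn : 21 ≤ n) {x : Grid 2 n}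
    (hx : toPlane x ∈ triangleR n \ segmentL n) :
    IsTeachingSet (witness n) (thresholdClass 2 n 2) (witnessTeachingSet n x) := by
  rw [witnessTeachingSet_eq hn]
  intro f' hf' hT
  obtain ⟨g, hg, h, hh, rfl⟩ := mem_thresholdClass_two_two.1 hf'
  have hwx : witness n x = false := by
    have := twelve_mul_mOf_le hn hx
    rw [← Bool.not_eq_true, witness_eq_true]
    omega
  have hxx := hT x (Or.inr rfl)
  rw [hwx, Bool.and_eq_false_iff] at hxx
  rcases hxx with hgx | hhx
  · obtain ⟨rfl, rfl⟩ := eq_witness_of_eq_false hn hg hh hx.1 hgx fun y hy => hT y (Or.inl hy)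
    exact funext fun y => Bool.and_comm _ _
  · obtain ⟨rfl, rfl⟩ := eq_witness_of_eq_false hn hh hg hx.1 hhx fun y hy => by
      rw [Bool.and_comm]
      exact hT y (Or.inl hy)
    rfl

theorem isMinimalTeachingSet_witnessTeachingSet {n : ℕ} (hn : 21 ≤ n) {x : Grid 2 n}
    (hx : toPlane x ∈ triangleR n \ segmentL n) :
    IsMinimalTeachingSet (witness n) (thresholdClass 2 n 2) (witnessTeachingSet n x) := by
  have hm := five_le_mOf hn
  refine isMinimalTeachingSet_of_diff (isTeachingSet_witnessTeachingSet hn hx) ?_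
  rintro z ((⟨g, hg, hz, hgz⟩ | ⟨g, hg, hz, hgz⟩) | rfl)
  · have hzc : z ∈ corners₁ n := essentialPoints_witness₁ hn ▸ ⟨g, hg, hz, hgz⟩
    have hz₂ : witness₂ n z = true := by
      rw [witness₂_eq_true]
      rcases hzc with h | h | h | h <;> omega
    refine ⟨_, mem_thresholdClass_two_two.2 ⟨g, hg, _, witness₂_mem n, rfl⟩, fun h => hz ?_,
      fun y _ hy => ?_⟩
    · simpa [witness, hz₂] using (congrFun h z).symm
    · rw [witness, hgz y hy]
  · have hzc : z ∈ corners₂ n := essentialPoints_witness₂ hn ▸ ⟨g, hg, hz, hgz⟩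
    have hz₁ : witness₁ n z = true := by
      rw [witness₁_eq_true]
      rcases hzc with h | h | h | h <;> omega
    refine ⟨_, mem_thresholdClass_two_two.2 ⟨_, witness₁_mem n, g, hg, rfl⟩, fun h => hz ?_,
      fun y _ hy => ?_⟩
    · simpa [witness, hz₁] using (congrFun h z).symm
    · rw [witness, hgz y hy]
  · -- Without `x`, the conjunction of `x₁ ≥ 1` and `x₂ ≥ 1` is not told apart from `f`.
    rw [witnessTeachingSet_eq hn]
    refine ⟨_, mem_thresholdClass_two_two.2 ⟨_, decide_mem_thresholdClass (-1) 0 (-1), _,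
      decide_mem_thresholdClass 0 (-1) (-1), rfl⟩, fun h => ?_, fun y hyT hy => ?_⟩
    · have := congrFun h (pt 1 1 (by omega) (by omega))
      rw [Bool.eq_iff_iff, witness_eq_true] at this
      simp at this
    · have hyc := hyT.resolve_right hy
      rw [Bool.eq_iff_iff, witness_eq_true, Bool.and_eq_true, decide_eq_true_iff,
        decide_eq_true_iff]
      rcases hyc with (h | h | h | h) | (h | h | h | h) <;> omega

/-! ### Counting -/

theorem sq_mOf_le_numMinimalTeachingSets {n : ℕ} (hn : 21 ≤ n) :
    mOf n ^ 2 ≤ numMinimalTeachingSets (witness n) (thresholdClass 2 n 2) := by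
  have hmn := four_mul_mOf_lt hn
  set box : Fin (mOf n) × Fin (mOf n) → Grid 2 n := fun q =>
    pt (2 * mOf n + q.1) (2 * mOf n + q.2) (by omega) (by omega) with hbox
  have hmem : ∀ q, toPlane (box q) ∈ triangleR n \ segmentL n := fun q =>
    toPlane_mem_of_box hn (by simp [hbox]) (by simp [hbox]; omega) (by simp [hbox])
      (by simp [hbox]; omega)
  have hinj : Function.Injective fun q => witnessTeachingSet n (box q) := by
    intro q r h
    have h := injOn_witnessTeachingSet hn (hmem q) (hmem r) h
    have h0 := congrArg (fun y : Grid 2 n => (y 0 : ℕ)) h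
    have h1 := congrArg (fun y : Grid 2 n => (y 1 : ℕ)) h
    simp only [hbox, pt_zero, pt_one] at h0 h1
    exact Prod.ext (Fin.ext (by omega)) (Fin.ext (by omega))
  calc mOf n ^ 2 = (Set.range fun q => witnessTeachingSet n (box q)).ncard := by
        rw [← Set.image_univ, Set.ncard_image_of_injective _ hinj, Set.ncard_univ,
          Nat.card_eq_fintype_card]
        simp [sq]
    _ ≤ _ := by
        refine Set.ncard_le_ncard ?_ (Set.toFinite _)
        rintro _ ⟨q, rfl⟩
        exact isMinimalTeachingSet_witnessTeachingSet hn (hmem q)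

theorem sq_le_numMinimalTeachingSets {n : ℕ} (hn : 21 ≤ n) :
    (1 / 64 : ℝ) * (n : ℝ) ^ 2 ≤
      (numMinimalTeachingSets (witness n) (thresholdClass 2 n 2) : ℝ) := by
  have h : (n : ℝ) ≤ 8 * mOf n := by
    have : n ≤ 8 * mOf n := by
      unfold mOf
      omega
    exact_mod_cast this
  calc (1 / 64 : ℝ) * (n : ℝ) ^ 2 ≤ (mOf n : ℝ) ^ 2 := by
        have := pow_le_pow_left₀ (Nat.cast_nonneg n) h 2
        linarith
    _ ≤ _ := by exact_mod_cast sq_mOf_le_numMinimalTeachingSets hn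

end KThreshold

theorem mainTheorem3 :
    (∃ c : ℝ, 0 < c ∧ ∃ N : ℕ, ∀ n : ℕ, N ≤ n →
      c * (n : ℝ) ^ 2 ≤ (KThreshold.maxNumMinimalTeachingSets 2 n 2 : ℝ)) ∧
    (∀ n : ℕ, 21 ≤ n →
      KThreshold.witness₁ n ∈ KThreshold.thresholdClass 2 n 1 ∧
      KThreshold.witness₂ n ∈ KThreshold.thresholdClass 2 n 1 ∧
      KThreshold.witness n ∈ KThreshold.thresholdClass 2 n 2 ∧
      (∀ x : KThreshold.Grid 2 n,
        KThreshold.toPlane x ∈ KThreshold.triangleR n \ KThreshold.segmentL n →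
        KThreshold.IsMinimalTeachingSet (KThreshold.witness n) (KThreshold.thresholdClass 2 n 2)
          (KThreshold.witnessTeachingSet n x)) ∧
      Set.InjOn (KThreshold.witnessTeachingSet n)
        {x | KThreshold.toPlane x ∈ KThreshold.triangleR n \ KThreshold.segmentL n}) ∧
    (∃ c : ℝ, 0 < c ∧ ∃ N : ℕ, ∀ n : ℕ, N ≤ n →
      c * (n : ℝ) ^ 2 ≤
        (KThreshold.numMinimalTeachingSets (KThreshold.witness n)
          (KThreshold.thresholdClass 2 n 2) : ℝ)) := by
  refine ⟨⟨1 / 64, by norm_num, 21, fun n hn =>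
      (KThreshold.sq_le_numMinimalTeachingSets hn).trans ?_⟩,
    fun n hn => ⟨KThreshold.witness₁_mem n, KThreshold.witness₂_mem n, KThreshold.witness_mem n,
      fun x hx => KThreshold.isMinimalTeachingSet_witnessTeachingSet hn hx,
      KThreshold.injOn_witnessTeachingSet hn⟩,
    ⟨1 / 64, by norm_num, 21, fun n hn => KThreshold.sq_le_numMinimalTeachingSets hn⟩⟩
  exact_mod_cast (KThreshold.isGreatest_maxNumMinimalTeachingSets 2 n 2).2
    ⟨_, KThreshold.witness_mem n, rfl⟩
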